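/- Let $\mathbb T$ be the unit circle with normalized Lebesgue measure $m$, let $L^2=L^2(\mathbb T,m)$ and $L^\infty=L^\infty(\mathbb T,m)$, let $H^2\subset L^2$ be the Hardy space, i.e. the closed subspace of those $f\in L^2$ whose Fourier coefficients of negative index all vanish, and let $P\colon L^2\to H^2$ be the orthogonal projection. For $\varphi\in L^\infty$ the Toeplitz operator $T_\varphi\colon H^2\to H^2$ is $T_\varphi f=P(\varphi f)$. An inner function is a function $\alpha\in L^\infty$ whose Fourier coefficients of negative index all vanish and which satisfies $|\alpha|=1$ a.e. on $\mathbb T$. For an inner function $\alpha$ let $K^2_\alpha=H^2\ominus\alpha H^2$, let $P_\alpha\colon L^2\to K^2_\alpha$ be the orthogonal projection, and let $C_\alpha\colon K^2_\alpha\to K^2_\alpha$ be the conjugation $C_\alpha f(z)=\alpha(z)\overline{zf(z)}$, $|z|=1$. For a bounded linear operator $A$ on $H^2$ put $A_\alpha=P_\alpha A|_{K^2_\alpha}\colon K^2_\alpha\to K^2_\alpha$. Let $A$ be a bounded linear operator on $H^2$. Then the following conditions are equivalent: (1) $A=T_\varphi$ for some $\varphi\in L^\infty$; (2) $C_\alpha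 A_\alpha C_\alpha=A_\alpha^*$ for every nonconstant inner function $\alpha$; (3) $C_\alpha A_\alpha C_\alpha=A_\alpha^*$ for every $\alpha=z^n$ with $n\ge 1$ an integer. -/

import Mathlib

open MeasureTheory
open scoped ENNReal InnerProductSpace

noncomputable section

namespace ModelSpace

/-- Normalized Lebesgue measure on the unit circle. The circle is parametrized by
`t ↦ z = exp (2 π i t)` with `t ∈ ℝ / ℤ`, so that `z ^ n` is `fourier n`. -/
abbrev circleMeasure : Measure UnitAddCircle := AddCircle.haarAddCircle

/-- `L²(𝕋, m)`. -/
abbrev L2 : Type := Lp ℂ 2 circleMeasure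

/-- `L^∞(𝕋, m)`. -/
abbrev Linf : Type := Lp ℂ ∞ circleMeasure

/-- The function `z ^ n` as an element of `L^∞`. -/
def zPow (n : ℤ) : Linf := fourierLp ∞ n

/-- Multiplication by `φ ∈ L^∞`, as a bounded operator on `L²`. -/
def mulOp (φ : Linf) : L2 →L[ℂ] L2 :=
  (ContinuousLinearMap.mul ℂ ℂ).holderL circleMeasure ∞ 2 2 φ

/-- The Hardy space `H²`, as the subspace of `L²` of the functions all of whose Fourier
coefficients of negative index vanish. -/
def hardySpace : Submodule ℂ L2 where
  carrier := {f | ∀ n : ℤ, n < 0 → fourierCoeff f n = 0}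
  zero_mem' := by
    intro n _
    rw [← fourierBasis_repr]
    simp
  add_mem' := by
    intro f g hf hg n hn
    have h1 := hf n hn
    have h2 := hg n hn
    rw [← fourierBasis_repr] at h1 h2 ⊢
    simp [h1, h2]
  smul_mem' := by
    intro c f hf n hn
    have h1 := hf n hn
    rw [← fourierBasis_repr] at h1 ⊢
    simp [h1]

theorem mem_hardySpace_iff {f : L2} :
    f ∈ hardySpace ↔ ∀ n : ℤ, n < 0 → ⟪(fourierLp 2 n : L2), f⟫_ℂ = 0 := by
  have h : ∀ n : ℤ, ⟪(fourierLp 2 n : L2), f⟫_ℂ = fourierCoeff f n := by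
    intro n
    rw [← fourierBasis_repr, fourierBasis.repr_apply_apply, coe_fourierBasis]
  simp only [h]
  rfl

theorem isClosed_hardySpace : IsClosed (hardySpace : Set L2) := by
  have h : (hardySpace : Set L2) =
      ⋂ n : ℤ, ⋂ _ : n < 0, {f : L2 | ⟪(fourierLp 2 n : L2), f⟫_ℂ = 0} := by
    ext f
    simp [mem_hardySpace_iff]
  rw [h]
  refine isClosed_iInter fun n => isClosed_iInter fun _ => ?_
  exact isClosed_eq (by fun_prop) continuous_const

instance : CompleteSpace hardySpace := isClosed_hardySpace.completeSpace_coe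

/-- The Toeplitz operator `T_φ f = P (φ f)` on `H²`, where `P : L² → H²` is the orthogonal
projection. -/
def toeplitz (φ : Linf) : hardySpace →L[ℂ] hardySpace :=
  hardySpace.orthogonalProjectionOnto ∘L mulOp φ ∘L hardySpace.subtypeL

/-- `α` is (the boundary function of) an inner function: a bounded function all of whose Fourier
coefficients of negative index vanish, and which is unimodular almost everywhere on the circle. -/
structure IsInner (α : Linf) : Prop where
  fourierCoeff_eq_zero : ∀ n : ℤ, n < 0 → fourierCoeff α n = 0
  norm_eq_one : ∀ᵐ t ∂circleMeasure, ‖α t‖ = 1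

/-- `α` is (almost everywhere equal to) a constant. -/
def IsConstant (α : Linf) : Prop := ∃ c : ℂ, ∀ᵐ t ∂circleMeasure, α t = c

/-- The model space `K²_α = H² ⊖ α H²`. -/
def modelSpace (α : Linf) : Submodule ℂ L2 :=
  hardySpace ⊓ (hardySpace.map (mulOp α : L2 →ₗ[ℂ] L2))ᗮ

theorem modelSpace_le (α : Linf) : modelSpace α ≤ hardySpace := inf_le_left

instance (α : Linf) : CompleteSpace (modelSpace α) :=
  (isClosed_hardySpace.inter (Submodule.isClosed_orthogonal _)).completeSpace_coe

/-- The inclusion `K²_α → H²`. -/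
def modelInclusion (α : Linf) : modelSpace α →L[ℂ] hardySpace :=
  (modelSpace α).subtypeL.codRestrict hardySpace fun f => modelSpace_le α f.2

/-- The compression `A_α = P_α A|K²_α` of an operator `A` on `H²` to the model space, where
`P_α : L² → K²_α` is the orthogonal projection. -/
def compression (A : hardySpace →L[ℂ] hardySpace) (α : Linf) :
    modelSpace α →L[ℂ] modelSpace α :=
  (modelSpace α).orthogonalProjectionOnto ∘L hardySpace.subtypeL ∘L A ∘L modelInclusion α

/-- The map `C_α f (z) = α(z) * conj (z * f(z))` on `L²`. -/
def conjL2 (α : Linf) (f : L2) : L2 := mulOp α (star (mulOp (zPow 1) f))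

theorem coeFn_mulOp (φ : Linf) (f : L2) :
    ∀ᵐ t ∂circleMeasure, mulOp φ f t = φ t * f t :=
  (ContinuousLinearMap.mul ℂ ℂ).coeFn_holder φ f

theorem coeFn_zPow (n : ℤ) : ∀ᵐ t ∂circleMeasure, zPow n t = fourier n t :=
  coeFn_fourierLp ∞ n

theorem coeFn_conjL2 (α : Linf) (f : L2) :
    ∀ᵐ t ∂circleMeasure, conjL2 α f t = α t * (starRingEnd ℂ) (fourier 1 t * f t) := by
  filter_upwards [coeFn_mulOp α (star (mulOp (zPow 1) f)), Lp.coeFn_star (mulOp (zPow 1) f),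
    coeFn_mulOp (zPow 1) f, coeFn_zPow 1] with t h1 h2 h3 h4
  rw [conjL2, h1, h2, Pi.star_apply, h3, h4]
  rfl

theorem fourierLp_mem_hardySpace {n : ℤ} (hn : 0 ≤ n) : (fourierLp 2 n : L2) ∈ hardySpace := by
  rw [mem_hardySpace_iff]
  intro m hm
  exact orthonormal_fourier.2 (by omega)

/-- `C_α` maps the model space of an inner function `α` into itself. -/
theorem conjL2_mem_modelSpace {α : Linf} (hα : IsInner α) {f : L2} (hf : f ∈ modelSpace α) :
    conjL2 α f ∈ modelSpace α := by
  obtain ⟨hf1, hf2⟩ := Submodule.mem_inf.1 hf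
  refine Submodule.mem_inf.2 ⟨?_, ?_⟩
  · rw [mem_hardySpace_iff]
    intro n hn
    have h0 : ⟪f, mulOp α (fourierLp 2 (-n - 1))⟫_ℂ = 0 :=
      (Submodule.mem_orthogonal' _ _).1 hf2 _
        (Submodule.mem_map_of_mem (fourierLp_mem_hardySpace (by omega)))
    rw [← h0, L2.inner_def, L2.inner_def]
    refine integral_congr_ae ?_
    filter_upwards [coeFn_conjL2 α f, coeFn_mulOp α (fourierLp 2 (-n - 1)),
      coeFn_fourierLp 2 n, coeFn_fourierLp 2 (-n - 1)] with t h1 h2 h3 h4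
    simp only [RCLike.inner_apply]
    rw [h1, h2, h3, h4, sub_eq_add_neg, fourier_add, ← fourier_neg, map_mul, ← fourier_neg]
    ring
  · rw [Submodule.mem_orthogonal]
    rintro _ ⟨h, hh, rfl⟩
    have key : ⟪mulOp α h, conjL2 α f⟫_ℂ = ⟪f, star (mulOp (zPow 1) h)⟫_ℂ := by
      rw [L2.inner_def, L2.inner_def]
      refine integral_congr_ae ?_
      filter_upwards [coeFn_conjL2 α f, coeFn_mulOp α h, hα.norm_eq_one,
        Lp.coeFn_star (mulOp (zPow 1) h), coeFn_mulOp (zPow 1) h, coeFn_zPow 1]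
        with t h1 h2 h3 h4 h5 h6
      have hu : α t * (starRingEnd ℂ) (α t) = 1 := by
        rw [RCLike.mul_conj, h3]
        simp
      simp only [RCLike.inner_apply]
      rw [h1, h2, h4, Pi.star_apply, h5, h6]
      simp only [map_mul, RCLike.star_def]
      linear_combination ((starRingEnd ℂ) (fourier 1 t) * (starRingEnd ℂ) (f t) *
        (starRingEnd ℂ) (h t)) * hu
    change ⟪mulOp α h, conjL2 α f⟫_ℂ = 0
    rw [key, ← fourierBasis.tsum_inner_mul_inner]
    refine (tsum_congr fun n => ?_).trans tsum_zero
    rw [coe_fourierBasis]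
    rcases lt_or_ge n 0 with hn | hn
    · rw [← inner_conj_symm, mem_hardySpace_iff.1 hf1 n hn]
      simp
    · have h0 := mem_hardySpace_iff.1 hh (-n - 1) (by omega)
      have h1 : ⟪(fourierLp 2 n : L2), star (mulOp (zPow 1) h)⟫_ℂ =
          ⟪h, (fourierLp 2 (-n - 1) : L2)⟫_ℂ := by
        rw [L2.inner_def, L2.inner_def]
        refine integral_congr_ae ?_
        filter_upwards [Lp.coeFn_star (mulOp (zPow 1) h), coeFn_mulOp (zPow 1) h, coeFn_zPow 1,
          coeFn_fourierLp 2 n, coeFn_fourierLp 2 (-n - 1)] with t h1 h2 h3 h4 h5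
        simp only [RCLike.inner_apply]
        rw [h1, Pi.star_apply, h2, h3, h4, h5, sub_eq_add_neg, fourier_add, fourier_neg,
          fourier_neg]
        simp only [map_mul, RCLike.star_def]
        ring
      rw [h1, ← inner_conj_symm h, h0]
      simp

/-- The conjugation `C_α` on the model space `K²_α` of an inner function `α`. -/
def modelConj {α : Linf} (hα : IsInner α) (f : modelSpace α) : modelSpace α :=
  ⟨conjL2 α f, conjL2_mem_modelSpace hα f.2⟩

/-- A bounded operator `A` is `C`-symmetric if `C A C = A*`. -/
def IsCSymmetric {H : Type*} [NormedAddCommGroup H] [InnerProductSpace ℂ H] [CompleteSpace H]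
    (C : H → H) (A : H →L[ℂ] H) : Prop :=
  ∀ f : H, C (A (C f)) = ContinuousLinearMap.adjoint A f

/-- `z ^ n` is inner for every natural number `n`. -/
theorem isInner_zPow (n : ℕ) : IsInner (zPow n) where
  fourierCoeff_eq_zero := by
    intro m hm
    have h := mem_hardySpace_iff.1 (fourierLp_mem_hardySpace (Int.natCast_nonneg n)) m hm
    rw [← h, L2.inner_def]
    refine integral_congr_ae ?_
    filter_upwards [coeFn_zPow n, coeFn_fourierLp 2 m, coeFn_fourierLp 2 (n : ℤ)]
      with t h1 h2 h3
    rw [RCLike.inner_apply, h1, h2, h3, ← fourier_neg, smul_eq_mul, mul_comm]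
  norm_eq_one := by
    filter_upwards [coeFn_zPow n] with t h1
    rw [h1, fourier_apply]
    exact Circle.norm_coe _

end ModelSpace

end

/-! The conjugation by `C_α` only inserts factors `α`, `z` and their conjugates. For a Toeplitz
operator the form on `H²` is that of multiplication by `φ`, so these unimodular factors cancel
pointwise (`isCSymmetric_compression_toeplitz`).

Conversely, `C_α` for `α = z^n` sends `z^k` to `z^(n-1-k)`, so symmetry says that the leading `n ×
n` corner of the matrix of `A` is invariant under reflection in its antidiagonal. Taking `n = i + j
+ 2`, the reflection carries the entry `(i+1, j+1)` to `(i, j)`: the matrix is constant along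
diagonals (`inner_mono_extend_succ`). Brown–Halmos (`exists_eq_toeplitz`) then recovers the symbol
from the operators `z^(-k) A z^k`, whose matrices stabilise entrywise to that of multiplication by
`φ`. -/

noncomputable section

namespace ModelSpace

open Filter

/-! ### Monomials and Fourier coefficients -/

/-- The function `z ^ n` as an element of `L²`. -/
abbrev mono (n : ℤ) : L2 := fourierLp 2 n

theorem mulOp_zPow_mono (k j : ℤ) : mulOp (zPow k) (mono j) = mono (j + k) := by
  refine Lp.ext ?_
  filter_upwards [coeFn_mulOp (zPow k) (mono j), coeFn_zPow k, coeFn_fourierLp 2 j,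
    coeFn_fourierLp 2 (j + k)] with t h1 h2 h3 h4
  rw [h1, h2, h3, h4, fourier_add, mul_comm]

theorem inner_mulOp_zPow (k : ℤ) (f g : L2) :
    ⟪f, mulOp (zPow k) g⟫_ℂ = ⟪mulOp (zPow (-k)) f, g⟫_ℂ := by
  rw [L2.inner_def, L2.inner_def]
  refine integral_congr_ae ?_
  filter_upwards [coeFn_mulOp (zPow k) g, coeFn_mulOp (zPow (-k)) f, coeFn_zPow k,
    coeFn_zPow (-k)] with t h1 h2 h3 h4
  simp only [RCLike.inner_apply]
  rw [h1, h2, h3, h4, map_mul, ← fourier_neg, neg_neg]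
  ring

theorem norm_mulOp_zPow (k : ℤ) (f : L2) : ‖mulOp (zPow k) f‖ = ‖f‖ := by
  have h : mulOp (zPow (-k)) (mulOp (zPow k) f) = f := by
    refine Lp.ext ?_
    filter_upwards [coeFn_mulOp (zPow (-k)) (mulOp (zPow k) f), coeFn_mulOp (zPow k) f,
      coeFn_zPow k, coeFn_zPow (-k)] with t h1 h2 h3 h4
    rw [h1, h2, h3, h4, ← mul_assoc, ← fourier_add]
    simp
  have h2 : ⟪mulOp (zPow k) f, mulOp (zPow k) f⟫_ℂ = ⟪f, f⟫_ℂ := by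
    rw [inner_mulOp_zPow, h]
  rw [@norm_eq_sqrt_re_inner ℂ, @norm_eq_sqrt_re_inner ℂ _ _ _ _ f, h2]

theorem ext_inner_mono {f g : L2} (h : ∀ m, ⟪mono m, f⟫_ℂ = ⟪mono m, g⟫_ℂ) : f = g := by
  refine fourierBasis.repr.injective (lp.ext (funext fun m => ?_))
  rw [fourierBasis.repr_apply_apply, fourierBasis.repr_apply_apply, coe_fourierBasis]
  exact h m

/-- A bounded sequence in `L²` whose Fourier coefficients are eventually constant has a weak
limit obeying the same bound. -/
theorem exists_of_eventually_inner_mono {u : ℕ → L2} {C : ℝ} (hC : 0 ≤ C)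
    (hu : ∀ k, ‖u k‖ ≤ C) {a : ℤ → ℂ}
    (ha : ∀ m, ∀ᶠ k in atTop, ⟪mono m, u k⟫_ℂ = a m) :
    ∃ v : L2, ‖v‖ ≤ C ∧ ∀ m, ⟪mono m, v⟫_ℂ = a m := by
  have hsum : ∀ s : Finset ℤ, ∑ m ∈ s, ‖a m‖ ^ 2 ≤ C ^ 2 := by
    intro s
    -- One `k` serves all of the finite set `s`, so Bessel's inequality for `u k` bounds the partial
    -- sum.
    obtain ⟨k, hk⟩ := ((s.eventually_all).2 fun m _ => ha m).exists
    calc ∑ m ∈ s, ‖a m‖ ^ 2 = ∑ m ∈ s, ‖⟪mono m, u k⟫_ℂ‖ ^ 2 :=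
          Finset.sum_congr rfl fun m hm => by rw [hk m hm]
      _ ≤ ‖u k‖ ^ 2 := orthonormal_fourier.sum_inner_products_le (u k)
      _ ≤ C ^ 2 := by gcongr; exact hu k
  have hsum' : ∀ s : Finset ℤ, ∑ m ∈ s, ‖a m‖ ^ (2 : ℝ≥0∞).toReal ≤ C ^ 2 := by
    simpa using hsum
  have hmem : Memℓp a 2 := memℓp_gen' hsum'
  let b : lp (fun _ : ℤ => ℂ) 2 := ⟨a, hmem⟩
  refine ⟨(fourierBasis (T := 1)).repr.symm b, ?_, fun m => ?_⟩
  · rw [LinearIsometryEquiv.norm_map]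
    exact lp.norm_le_of_forall_sum_le (by simp) hC (by simpa [b] using hsum)
  · have := (fourierBasis (T := 1)).repr_apply_apply (fourierBasis.repr.symm b) m
    rw [coe_fourierBasis, LinearIsometryEquiv.apply_symm_apply] at this
    exact this.symm

/-! ### Operators on `H²` viewed on `L²` -/

/-- The orthogonal projection of `L²` onto `H²` followed by `A`, as an operator on `L²`. -/
def extend (A : hardySpace →L[ℂ] hardySpace) : L2 →L[ℂ] L2 :=
  hardySpace.subtypeL ∘L A ∘L hardySpace.orthogonalProjectionOnto

theorem extend_coe (A : hardySpace →L[ℂ] hardySpace) (f : hardySpace) :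
    extend A f = A f := by
  simp [extend]

theorem norm_extend_le (A : hardySpace →L[ℂ] hardySpace) (f : L2) :
    ‖extend A f‖ ≤ ‖A‖ * ‖f‖ := by
  refine (A.le_opNorm _).trans ?_
  gcongr
  exact hardySpace.norm_orthogonalProjectionOnto_apply_le f

theorem extend_mono_of_neg (A : hardySpace →L[ℂ] hardySpace) {j : ℤ} (hj : j < 0) :
    extend A (mono j) = 0 := by
  have : hardySpace.orthogonalProjectionOnto (mono j) = 0 := by
    rw [Submodule.orthogonalProjectionOnto_eq_zero_iff, Submodule.mem_orthogonal']
    exact fun f hf => mem_hardySpace_iff.1 hf j hj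
  simp [extend, this]

theorem inner_mono_extend_of_neg (A : hardySpace →L[ℂ] hardySpace) {m : ℤ} (hm : m < 0) (f : L2) :
    ⟪mono m, extend A f⟫_ℂ = 0 :=
  mem_hardySpace_iff.1 (A _).2 m hm

theorem inner_extend_toeplitz {φ : Linf} {f g : L2} (hf : f ∈ hardySpace) (hg : g ∈ hardySpace) :
    ⟪f, extend (toeplitz φ) g⟫_ℂ = ⟪f, mulOp φ g⟫_ℂ := by
  lift g to hardySpace using hg
  rw [extend_coe]
  lift f to hardySpace using hf
  exact hardySpace.inner_starProjection_left_eq_right f (mulOp φ g) |>.symm.trans (by simp)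

/-! ### Bounded multipliers of `L²` -/

theorem dense_span_mono : Dense (Submodule.span ℂ (Set.range mono) : Set L2) :=
  Submodule.dense_iff_topologicalClosure_eq_top.2 (span_fourierLp_closure_eq_top (by simp))

/-- If multiplication by `φ ∈ L²` is bounded on trigonometric polynomials in the `L²` norm, then
it is bounded with the same bound on `L²`. -/
theorem eLpNorm_mul_le_of_span {φ : L2} {C : ℝ}
    (h : ∀ p ∈ Submodule.span ℂ (Set.range mono),
      ∃ q : L2, q =ᵐ[circleMeasure] (fun t => φ t * p t) ∧ ‖q‖ ≤ C * ‖p‖) (f : L2) :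
    eLpNorm (fun t => φ t * f t) 2 circleMeasure ≤ ENNReal.ofReal (C * ‖f‖) := by
  obtain ⟨p, hp, hpf⟩ := mem_closure_iff_seq_limit.1 (dense_span_mono f)
  -- An a.e. convergent subsequence of the approximating polynomials allows Fatou's lemma.
  obtain ⟨ns, hns, hae⟩ :=
    (tendstoInMeasure_of_tendsto_Lp hpf).exists_seq_tendsto_ae
  choose q hq hqn using fun n => h (p n) (hp n)
  have hle := Lp.eLpNorm_lim_le_liminf_eLpNorm (p := 2) (μ := circleMeasure)
    (f := fun n => (q (ns n) : UnitAddCircle → ℂ)) (fun n => Lp.aestronglyMeasurable _)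
    (fun t => φ t * f t) (by
      filter_upwards [hae, ae_all_iff.2 fun n => hq n] with t ht hqt
      simp only [hqt]
      exact ht.const_mul _)
  refine hle.trans ?_
  have hlim : Tendsto (fun n => ENNReal.ofReal (C * ‖p (ns n)‖)) atTop
      (nhds (ENNReal.ofReal (C * ‖f‖))) :=
    ENNReal.tendsto_ofReal (((hpf.comp hns.tendsto_atTop).norm).const_mul C)
  rw [← hlim.liminf_eq]
  refine liminf_le_liminf (Eventually.of_forall fun n => ?_)
  rw [← ENNReal.ofReal_toReal (Lp.eLpNorm_ne_top (q (ns n)))]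
  exact ENNReal.ofReal_le_ofReal (hqn (ns n))

theorem eLpNorm_two_sq (f : UnitAddCircle → ℂ) :
    eLpNorm f 2 circleMeasure ^ 2 = ∫⁻ t, ‖f t‖ₑ ^ 2 ∂circleMeasure := by
  have := eLpNorm_nnreal_pow_eq_lintegral (μ := circleMeasure) (f := f) (p := 2) two_ne_zero
  simpa using this

/-- A function multiplying `L²` boundedly into itself is essentially bounded. -/
theorem ae_norm_le_of_eLpNorm_mul_le {φ : L2} {C : ℝ} (hC : 0 ≤ C)
    (h : ∀ f : L2, eLpNorm (fun t => φ t * f t) 2 circleMeasure ≤ ENNReal.ofReal (C * ‖f‖)) :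
    ∀ᵐ t ∂circleMeasure, ‖φ t‖ ≤ C := by
  have key : (fun t => ‖φ t‖ₑ ^ 2) ≤ᵐ[circleMeasure] fun _ => ENNReal.ofReal C ^ 2 := by
    refine ae_le_of_forall_setLIntegral_le_of_sigmaFinite₀
      ((Lp.aestronglyMeasurable φ).enorm.pow_const 2) fun s hs _ => ?_
    -- Testing on the indicator of `s` compares the integral of `|φ|²` over `s` with `C²` times the
    -- measure of `s`.
    let f : L2 := indicatorConstLp 2 hs (measure_ne_top circleMeasure s) (1 : ℂ)
    have hf : ENNReal.ofReal ‖f‖ ^ 2 = circleMeasure s := by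
      rw [Lp.norm_def, ENNReal.ofReal_toReal (Lp.eLpNorm_ne_top f), eLpNorm_two_sq,
        ← setLIntegral_one, ← lintegral_indicator hs]
      refine lintegral_congr_ae ?_
      filter_upwards [indicatorConstLp_coeFn (p := 2) (hs := hs)
        (hμs := measure_ne_top circleMeasure s) (c := (1 : ℂ))] with t ht
      rw [ht]
      by_cases hts : t ∈ s <;> simp [hts]
    have h2 : eLpNorm (fun t => φ t * f t) 2 circleMeasure ^ 2
        = ∫⁻ t in s, ‖φ t‖ₑ ^ 2 ∂circleMeasure := by
      rw [eLpNorm_two_sq, ← lintegral_indicator hs]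
      refine lintegral_congr_ae ?_
      filter_upwards [indicatorConstLp_coeFn (p := 2) (hs := hs)
        (hμs := measure_ne_top circleMeasure s) (c := (1 : ℂ))] with t ht
      rw [ht]
      by_cases hts : t ∈ s <;> simp [hts]
    rw [← h2, setLIntegral_const, ← hf, ← mul_pow, ← ENNReal.ofReal_mul hC]
    gcongr
    exact h f
  filter_upwards [key] with t ht
  have := (ENNReal.pow_le_pow_left_iff two_ne_zero).1 ht
  rwa [← ofReal_norm, ENNReal.ofReal_le_ofReal_iff hC] at this

theorem inner_mono_mul {φ q : L2} {m j : ℤ}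
    (hq : q =ᵐ[circleMeasure] fun t => φ t * mono j t) :
    ⟪mono m, q⟫_ℂ = ⟪mono (m - j), φ⟫_ℂ := by
  have : q = mulOp (zPow j) φ := by
    refine Lp.ext ?_
    filter_upwards [hq, coeFn_mulOp (zPow j) φ, coeFn_zPow j, coeFn_fourierLp 2 j]
      with t h1 h2 h3 h4
    rw [h1, h2, h3, h4, mul_comm]
  rw [this, inner_mulOp_zPow, mulOp_zPow_mono, sub_eq_add_neg]

/-! ### The Brown–Halmos theorem -/

/-- The Brown–Halmos theorem: a bounded operator on `H²` whose matrix is constant along diagonals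
is a Toeplitz operator. -/
theorem exists_eq_toeplitz {A : hardySpace →L[ℂ] hardySpace}
    (hA : ∀ i j : ℤ, 0 ≤ i → 0 ≤ j →
      ⟪mono (i + 1), extend A (mono (j + 1))⟫_ℂ = ⟪mono i, extend A (mono j)⟫_ℂ) :
    ∃ φ : Linf, A = toeplitz φ := by
  have hshift : ∀ (k : ℕ) (i j : ℤ), 0 ≤ i → 0 ≤ j →
      ⟪mono (i + k), extend A (mono (j + k))⟫_ℂ = ⟪mono i, extend A (mono j)⟫_ℂ := by
    intro k i j hi hj
    induction k with
    | zero => simp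
    | succ k ih =>
      rw [← ih, ← hA (i + k) (j + k) (by omega) (by omega)]
      push_cast
      simp only [add_assoc]
  -- The indices `d + |d|` and `|d|` are nonnegative and differ by `d`, so they pick an entry of the
  -- diagonal `d`.
  let a : ℤ → ℂ := fun d => ⟪mono (d + d.natAbs), extend A (mono d.natAbs)⟫_ℂ
  have ha : ∀ i j : ℤ, 0 ≤ i → 0 ≤ j → ⟪mono i, extend A (mono j)⟫_ℂ = a (i - j) := by
    intro i j hi hj
    lift j to ℕ using hj
    have h1 := hshift (i - j).natAbs i j hi (by omega)
    have h2 := hshift j (i - j + (i - j).natAbs) (i - j).natAbs (by omega) (by omega)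
    rw [show i - j + (i - j).natAbs + j = i + (i - j).natAbs by ring,
      add_comm ((i - j).natAbs : ℤ) j] at h2
    exact h1.symm.trans h2
  -- The matrix of `B k` is that of `A` with its corner moved to `(-k, -k)`; each fixed entry is
  -- eventually inside.
  let B : ℕ → L2 →L[ℂ] L2 := fun k =>
    mulOp (zPow (-(k : ℤ))) ∘L extend A ∘L mulOp (zPow k)
  have hBnorm : ∀ k f, ‖B k f‖ ≤ ‖A‖ * ‖f‖ := by
    intro k f
    refine (norm_mulOp_zPow _ _).trans_le ((norm_extend_le A _).trans_eq ?_)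
    exact congrArg (‖A‖ * ·) (norm_mulOp_zPow _ _)
  have hB : ∀ m j, ∀ᶠ k in atTop, ⟪mono m, B k (mono j)⟫_ℂ = a (m - j) := by
    intro m j
    filter_upwards [eventually_ge_atTop (m.natAbs + j.natAbs)] with k hk
    change ⟪mono m, mulOp (zPow (-(k : ℤ))) (extend A (mulOp (zPow k) (mono j)))⟫_ℂ = _
    rw [inner_mulOp_zPow, neg_neg, mulOp_zPow_mono, mulOp_zPow_mono,
      ha _ _ (by omega) (by omega), add_sub_add_right_eq_sub]
  obtain ⟨φ, -, hφ⟩ := exists_of_eventually_inner_mono (u := fun k => B k (mono 0)) (by positivity)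
    (fun k => hBnorm k _) (fun m => hB m 0)
  simp only [sub_zero] at hφ
  have hspan : ∀ p ∈ Submodule.span ℂ (Set.range mono),
      ∃ q : L2, q =ᵐ[circleMeasure] (fun t => φ t * p t) ∧
        ∀ m, ∀ᶠ k in atTop, ⟪mono m, B k p⟫_ℂ = ⟪mono m, q⟫_ℂ := by
    intro p hp
    induction hp using Submodule.span_induction with
    | mem p hp =>
      obtain ⟨j, rfl⟩ := hp
      have hq : mulOp (zPow j) φ =ᵐ[circleMeasure] fun t => φ t * mono j t := by
        filter_upwards [coeFn_mulOp (zPow j) φ, coeFn_zPow j, coeFn_fourierLp 2 j]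
          with t h2 h3 h4
        rw [h2, h3, h4, mul_comm]
      refine ⟨_, hq, fun m => ?_⟩
      rw [inner_mono_mul hq, hφ]
      exact hB m j
    | zero =>
      refine ⟨0, ?_, by simp⟩
      filter_upwards [Lp.coeFn_zero ℂ 2 circleMeasure] with t ht
      rw [ht, Pi.zero_apply, mul_zero]
    | add p₁ p₂ _ _ h₁ h₂ =>
      obtain ⟨q₁, h₁, h₁'⟩ := h₁
      obtain ⟨q₂, h₂, h₂'⟩ := h₂
      refine ⟨q₁ + q₂, ?_, fun m => ?_⟩
      · filter_upwards [h₁, h₂, Lp.coeFn_add q₁ q₂, Lp.coeFn_add p₁ p₂] with t e₁ e₂ e₃ e₄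
        rw [e₃, e₄, Pi.add_apply, Pi.add_apply, e₁, e₂, mul_add]
      · filter_upwards [h₁' m, h₂' m] with k e₁ e₂
        rw [map_add, inner_add_right, inner_add_right, e₁, e₂]
    | smul c p _ h =>
      obtain ⟨q, h, h'⟩ := h
      refine ⟨c • q, ?_, fun m => ?_⟩
      · filter_upwards [h, Lp.coeFn_smul c q, Lp.coeFn_smul c p] with t e₁ e₂ e₃
        rw [e₂, e₃, Pi.smul_apply, Pi.smul_apply, e₁, smul_eq_mul, smul_eq_mul, mul_left_comm]
      · filter_upwards [h' m] with k e
        rw [map_smul, inner_smul_right, inner_smul_right, e]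
  have hbound : ∀ᵐ t ∂circleMeasure, ‖φ t‖ ≤ ‖A‖ := by
    refine ae_norm_le_of_eLpNorm_mul_le (norm_nonneg A) (eLpNorm_mul_le_of_span fun p hp => ?_)
    obtain ⟨q, hq, hq'⟩ := hspan p hp
    -- The weak limit of `B k p` has the coefficients of `q = φ p`, so `q` inherits the bound `‖A‖ *
    -- ‖p‖`.
    obtain ⟨v, hv, hv'⟩ := exists_of_eventually_inner_mono (u := fun k => B k p) (by positivity)
      (fun k => hBnorm k p) hq'
    exact ⟨q, hq, by rwa [← ext_inner_mono hv']⟩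
  have hmem : MemLp φ ∞ circleMeasure :=
    memLp_top_of_bound (Lp.aestronglyMeasurable φ) ‖A‖ hbound
  let Φ : Linf := hmem.toLp φ
  have hext : extend A = extend (toeplitz Φ) := by
    refine ContinuousLinearMap.ext_on dense_span_mono ?_
    rintro _ ⟨j, rfl⟩
    rcases lt_or_ge j 0 with hj | hj
    · rw [extend_mono_of_neg _ hj, extend_mono_of_neg _ hj]
    refine ext_inner_mono fun m => ?_
    rcases lt_or_ge m 0 with hm | hm
    · rw [inner_mono_extend_of_neg _ hm, inner_mono_extend_of_neg _ hm]
    rw [inner_extend_toeplitz (fourierLp_mem_hardySpace hm) (fourierLp_mem_hardySpace hj),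
      ha m j hm hj, ← hφ]
    refine (inner_mono_mul ?_).symm
    filter_upwards [coeFn_mulOp Φ (mono j), hmem.coeFn_toLp] with t h1 h2
    rw [h1, h2]
  refine ⟨Φ, ContinuousLinearMap.ext fun f => Subtype.ext ?_⟩
  rw [← extend_coe, hext, extend_coe]

/-! ### Symmetry of compressions -/

/-- Both sides integrate `conj α * z * f * g`, which is symmetric in `f` and `g`. -/
theorem inner_conjL2_comm (α : Linf) (f g : L2) : ⟪conjL2 α f, g⟫_ℂ = ⟪conjL2 α g, f⟫_ℂ := by
  rw [L2.inner_def, L2.inner_def]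
  refine integral_congr_ae ?_
  filter_upwards [coeFn_conjL2 α f, coeFn_conjL2 α g] with t h1 h2
  simp only [RCLike.inner_apply]
  rw [h1, h2]
  simp only [map_mul, Complex.conj_conj]
  ring

theorem inner_compression (A : hardySpace →L[ℂ] hardySpace) {α : Linf} (f g : modelSpace α) :
    ⟪f, compression A α g⟫_ℂ = ⟪(f : L2), extend A g⟫_ℂ := by
  have h : extend A g = A (modelInclusion α g) := extend_coe A (modelInclusion α g)
  rw [h]
  exact (modelSpace α).inner_starProjection_left_eq_right f (A (modelInclusion α g) : L2)
    |>.symm.trans (by simp)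

/-- `C_α`-symmetry of a compression, expressed by the sesquilinear form of the operator. -/
theorem isCSymmetric_compression_iff (A : hardySpace →L[ℂ] hardySpace) {α : Linf}
    (hα : IsInner α) :
    IsCSymmetric (modelConj hα) (compression A α) ↔
      ∀ f ∈ modelSpace α, ∀ g ∈ modelSpace α,
        ⟪conjL2 α g, extend A (conjL2 α f)⟫_ℂ = ⟪f, extend A g⟫_ℂ := by
  have key : ∀ f g : modelSpace α,
      ⟪modelConj hα (compression A α (modelConj hα f)), g⟫_ℂ =
        ⟪conjL2 α g, extend A (conjL2 α f)⟫_ℂ := by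
    intro f g
    refine (inner_conjL2_comm α _ _).trans ?_
    exact inner_compression A (modelConj hα g) (modelConj hα f)
  constructor
  · intro h f hf g hg
    have := key ⟨f, hf⟩ ⟨g, hg⟩
    rw [h, ContinuousLinearMap.adjoint_inner_left, inner_compression] at this
    exact this.symm
  · intro h f
    refine ext_inner_right ℂ fun g => ?_
    rw [key, ContinuousLinearMap.adjoint_inner_left, inner_compression]
    exact h f f.2 g g.2

theorem isCSymmetric_compression_toeplitz (φ : Linf) {α : Linf} (hα : IsInner α) :
    IsCSymmetric (modelConj hα) (compression (toeplitz φ) α) := by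
  rw [isCSymmetric_compression_iff]
  intro f hf g hg
  rw [inner_extend_toeplitz (modelSpace_le α hf) (modelSpace_le α hg),
    inner_extend_toeplitz (modelSpace_le α (conjL2_mem_modelSpace hα hg))
      (modelSpace_le α (conjL2_mem_modelSpace hα hf)), L2.inner_def, L2.inner_def]
  refine integral_congr_ae ?_
  filter_upwards [coeFn_conjL2 α f, coeFn_conjL2 α g, coeFn_mulOp φ (conjL2 α f),
    coeFn_mulOp φ g, hα.norm_eq_one] with t h1 h2 h3 h4 h5
  have hu : α t * (starRingEnd ℂ) (α t) = 1 := by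
    rw [RCLike.mul_conj, h5]
    simp
  have hz : fourier 1 t * (starRingEnd ℂ) (fourier 1 t) = 1 := by
    rw [← fourier_neg, ← fourier_add]
    simp
  simp only [RCLike.inner_apply]
  rw [h3, h1, h2, h4]
  simp only [map_mul, Complex.conj_conj]
  linear_combination (φ t * g t * (starRingEnd ℂ) (f t)) *
    (fourier 1 t * (starRingEnd ℂ) (fourier 1 t) * hu + hz)

/-! ### The inner functions `z^n` -/

theorem not_isConstant_zPow {n : ℕ} (hn : 1 ≤ n) : ¬ IsConstant (zPow n) := by
  rintro ⟨c, hc⟩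
  have h : mono n = c • mono 0 := by
    refine Lp.ext ?_
    filter_upwards [hc, coeFn_zPow n, coeFn_fourierLp 2 (n : ℤ), coeFn_fourierLp 2 0,
      Lp.coeFn_smul c (mono 0)] with t h1 h2 h3 h4 h5
    rw [h5, Pi.smul_apply, h4, h3, ← h2, h1]
    simp
  have h0 : ⟪mono n, mono 0⟫_ℂ = 0 := orthonormal_fourier.2 (by omega)
  have h1 : ⟪mono n, mono n⟫_ℂ = 1 := by
    rw [inner_self_eq_norm_sq_to_K, orthonormal_fourier.1]
    simp
  nth_rewrite 2 [h] at h1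
  rw [inner_smul_right, h0] at h1
  simp at h1

theorem mono_mem_modelSpace_zPow {n : ℕ} {k : ℤ} (hk : 0 ≤ k) (hkn : k < n) :
    mono k ∈ modelSpace (zPow n) := by
  refine Submodule.mem_inf.2 ⟨fourierLp_mem_hardySpace hk, ?_⟩
  rw [Submodule.mem_orthogonal']
  rintro _ ⟨f, hf, rfl⟩
  change ⟪mono k, mulOp (zPow n) f⟫_ℂ = 0
  rw [inner_mulOp_zPow, mulOp_zPow_mono]
  exact mem_hardySpace_iff.1 hf _ (by omega)

theorem conjL2_zPow_mono (n k : ℤ) : conjL2 (zPow n) (mono k) = mono (n - 1 - k) := by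
  refine Lp.ext ?_
  filter_upwards [coeFn_conjL2 (zPow n) (mono k), coeFn_zPow n, coeFn_fourierLp 2 k,
    coeFn_fourierLp 2 (n - 1 - k)] with t h1 h2 h3 h4
  rw [h1, h2, h3, h4, ← fourier_add, ← fourier_neg, ← fourier_add,
    show n + -(1 + k) = n - 1 - k by ring]

theorem inner_mono_extend_succ {A : hardySpace →L[ℂ] hardySpace}
    (h : ∀ n : ℕ, 1 ≤ n →
      IsCSymmetric (modelConj (isInner_zPow n)) (compression A (zPow n)))
    (i j : ℤ) (hi : 0 ≤ i) (hj : 0 ≤ j) :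
    ⟪mono (i + 1), extend A (mono (j + 1))⟫_ℂ = ⟪mono i, extend A (mono j)⟫_ℂ := by
  have hflip : ∀ (n : ℕ) (i j : ℤ), 0 ≤ i → 0 ≤ j → i < n → j < n →
      ⟪mono (n - 1 - j), extend A (mono (n - 1 - i))⟫_ℂ = ⟪mono i, extend A (mono j)⟫_ℂ := by
    intro n i j hi hj hin hjn
    have := (isCSymmetric_compression_iff A (isInner_zPow n)).1 (h n (by omega)) _
      (mono_mem_modelSpace_zPow hi hin) _ (mono_mem_modelSpace_zPow hj hjn)
    rwa [conjL2_zPow_mono, conjL2_zPow_mono] at this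
  lift i to ℕ using hi
  lift j to ℕ using hj
  -- The reflection for `n = i + j + 1` fixes `(i, j)` and only matches the form of the other side;
  -- the one for `n = i + j + 2` does the work.
  rw [← hflip (i + j + 1) i j (by omega) (by omega) (by omega) (by omega),
    ← hflip (i + j + 2) (i + 1) (j + 1) (by omega) (by omega) (by omega) (by omega)]
  rw [show ((i + j + 2 : ℕ) : ℤ) - 1 - (j + 1) = ((i + j + 1 : ℕ) : ℤ) - 1 - j by push_cast; ring,
    show ((i + j + 2 : ℕ) : ℤ) - 1 - (i + 1) = ((i + j + 1 : ℕ) : ℤ) - 1 - i by push_cast; ring]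

end ModelSpace
end

theorem theorem2p2 (A : ModelSpace.hardySpace →L[ℂ] ModelSpace.hardySpace) :
    List.TFAE [
      ∃ φ : ModelSpace.Linf, A = ModelSpace.toeplitz φ,
      ∀ (α : ModelSpace.Linf) (hα : ModelSpace.IsInner α), ¬ ModelSpace.IsConstant α →
        ModelSpace.IsCSymmetric (ModelSpace.modelConj hα) (ModelSpace.compression A α),
      ∀ n : ℕ, 1 ≤ n →
        ModelSpace.IsCSymmetric (ModelSpace.modelConj (ModelSpace.isInner_zPow n))
          (ModelSpace.compression A (ModelSpace.zPow n))] := by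
  tfae_have 1 → 2 := by
    rintro ⟨φ, rfl⟩ α hα _
    exact ModelSpace.isCSymmetric_compression_toeplitz φ hα
  tfae_have 2 → 3 := fun h n hn =>
    h _ (ModelSpace.isInner_zPow n) (ModelSpace.not_isConstant_zPow hn)
  tfae_have 3 → 1 := fun h =>
    ModelSpace.exists_eq_toeplitz (ModelSpace.inner_mono_extend_succ h)
  tfae_finish
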